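/- Let $n\ge 2$ be an integer, and let $\|\cdot\|$ be the Euclidean norm on $\mathbb{R}^n\supset\mathbb{Z}^n$. Let $\mathbb{T}^n=\mathbb{R}^n/\mathbb{Z}^n$ be the flat torus, with the distance induced by $\|\cdot\|$. For $\tau>n-1$, $\gamma>0$ and $N\ge 1$ let $$\mathcal{D}^1_n(\tau,\gamma)=\{\alpha\in\mathbb{R}^n : \|\alpha\|=1,\ |k\cdot\alpha|\ge\gamma\|k\|^{-\tau}\text{ for all }k\in\mathbb{Z}^n\setminus\{0\}\},$$ $$\mathcal{D}^1_n(\tau,\gamma,N)=\{\alpha\in\mathbb{R}^n : \|\alpha\|=1,\ |k\cdot\alpha|\ge\gamma\|k\|^{-\tau}\text{ for all }k\in\mathbb{Z}^n\text{ with }0<\|k\|\le N\}.$$ Theorem 1. Let $\tau>n-1$ and $\gamma\in(0,1)$ be such that $\mathcal{D}^1_n(\tau,\gamma)$ is nonempty. Let $\delta\in(0,\tfrac12)$ and $N^*=(1+n^2\,n!)/\delta$. Then for every $\alpha\in\mathcal{D}^1_n(\tau,\gamma,N^*)$ there is a time $T\ge 0$ with $$T<\frac{(1+n^2\,n!)^{\tau+1}}{\gamma\,\delta^\tau}$$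 such that the linear flow $\theta\mapsto\theta+t\alpha$ fills $\mathbb{T}^n$ to within $\delta$ after time $T$, that is: for every starting point $\theta\in\mathbb{T}^n$, every closed ball of radius $\delta$ in $\mathbb{T}^n$ contains a point of the orbit segment $\{\theta+t\alpha : 0\le t\le T\}$. -/

import Mathlib

open scoped Nat

noncomputable section

/-- The inclusion of `ℤⁿ` in Euclidean space `ℝⁿ`. -/
def intVec (n : ℕ) : (Fin n → ℤ) →+ EuclideanSpace ℝ (Fin n) where
  toFun k := WithLp.toLp 2 (fun i => (k i : ℝ))
  map_zero' := by ext i; simp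
  map_add' k l := by ext i; simp

/-- `ℤⁿ` as a subgroup of Euclidean space `ℝⁿ`. -/
def integerLattice (n : ℕ) : AddSubgroup (EuclideanSpace ℝ (Fin n)) := (intVec n).range

/-- The flat torus `ℝⁿ / ℤⁿ`. It carries Mathlib's quotient metric: the distance of two classes is
the infimum of the Euclidean distances of their representatives. -/
abbrev FlatTorus (n : ℕ) : Type := EuclideanSpace ℝ (Fin n) ⧸ integerLattice n

/-- The linear flow `θ ↦ θ + t α` on the torus. -/
def linearFlow {n : ℕ} (α : EuclideanSpace ℝ (Fin n)) (t : ℝ) (θ : FlatTorus n) : FlatTorus n :=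
  θ + QuotientAddGroup.mk (t • α)

/-- The linear flow with direction `α` fills the torus to within `δ` after time `T`: for every
starting point `θ`, every closed ball of radius `δ` contains a point of the orbit segment
`{θ + t α | 0 ≤ t ≤ T}`. -/
def FillsWithin {n : ℕ} (α : EuclideanSpace ℝ (Fin n)) (δ T : ℝ) : Prop :=
  ∀ θ p : FlatTorus n,
    (Metric.closedBall p δ ∩ (fun t => linearFlow α t θ) '' Set.Icc 0 T).Nonempty

/-- The Diophantine vectors in `ℝⁿ`. -/
def diophantine (n : ℕ) (τ γ : ℝ) : Set (EuclideanSpace ℝ (Fin n)) :=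
  {α | ∀ k : Fin n → ℤ, k ≠ 0 → γ * ‖intVec n k‖ ^ (-τ) ≤ |inner ℝ (intVec n k) α|}

/-- The Diophantine vectors in `ℝⁿ` with truncation order `N`. -/
def truncDiophantine (n : ℕ) (τ γ N : ℝ) : Set (EuclideanSpace ℝ (Fin n)) :=
  {α | ∀ k : Fin n → ℤ, 0 < ‖intVec n k‖ → ‖intVec n k‖ ≤ N →
    γ * ‖intVec n k‖ ^ (-τ) ≤ |inner ℝ (intVec n k) α|}

/-- The Diophantine vectors of unit length. -/
def diophantineUnit (n : ℕ) (τ γ : ℝ) : Set (EuclideanSpace ℝ (Fin n)) :=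
  Metric.sphere 0 1 ∩ diophantine n τ γ

/-- The truncated Diophantine vectors of unit length. -/
def truncDiophantineUnit (n : ℕ) (τ γ N : ℝ) : Set (EuclideanSpace ℝ (Fin n)) :=
  Metric.sphere 0 1 ∩ truncDiophantine n τ γ N

/-- The critical truncation order `N* = (1 + n² n!) / δ`. -/
def criticalOrder (n : ℕ) (δ : ℝ) : ℝ := (1 + (n : ℝ) ^ 2 * (n ! : ℝ)) / δ

end

open scoped Nat

/-! The proof is a transference argument. Consider the body of vectors with component at most `a`
along `α` and at most `δ` orthogonal to it. If its integer translates cover space, every orbit is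
`δ`-dense after time `2 * a`. A linear rescaling turns the question into whether a lattice has
covering radius at most 1. By `exists_dual_vector_covering`, failure yields a short nonzero dual
vector. Undoing the scaling makes it an integer vector `k` with `|k · α|` too small for the
Diophantine condition, while `‖k‖ ≤ N`. -/

/-! ### Lattice reduction and a transference bound -/

/-- A discrete subgroup has a vector which is shortest up to a factor `√2`. -/
theorem exists_near_shortest {V : Type*} [NormedAddCommGroup V] (L : AddSubgroup V)
    (hne : ∃ x ∈ L, x ≠ 0) {ε : ℝ} (hε : 0 < ε) (hd : ∀ x ∈ L, x ≠ 0 → ε ≤ ‖x‖) :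
    ∃ v ∈ L, v ≠ 0 ∧ ∀ x ∈ L, x ≠ 0 → ‖v‖ ^ 2 ≤ 2 * ‖x‖ ^ 2 := by
  set S : Set ℝ := {s | ∃ x ∈ L, x ≠ 0 ∧ s = ‖x‖ ^ 2} with hS
  obtain ⟨x₀, hx₀, hx₀'⟩ := hne
  have hSne : S.Nonempty := ⟨_, x₀, hx₀, hx₀', rfl⟩
  have hlow : ∀ s ∈ S, ε ^ 2 ≤ s := by
    rintro s ⟨x, hx, hx0, rfl⟩
    exact pow_le_pow_left₀ hε.le (hd x hx hx0) 2
  have hinf : ε ^ 2 ≤ sInf S := le_csInf hSne hlow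
  -- `ε` makes the infimum positive, so it need not be attained.
  have hlt : sInf S < 2 * sInf S := by nlinarith
  obtain ⟨_, ⟨v, hv, hv0, rfl⟩, hvlt⟩ := exists_lt_of_csInf_lt hSne hlt
  refine ⟨v, hv, hv0, fun x hx hx0 => ?_⟩
  have := csInf_le ⟨_, hlow⟩ (show ‖x‖ ^ 2 ∈ S from ⟨x, hx, hx0, rfl⟩)
  linarith

section Reduction

variable {V : Type*} [NormedAddCommGroup V] [InnerProductSpace ℝ V]

theorem exists_mem_ne_zero_of_span_eq_top [Nontrivial V] (L : AddSubgroup V)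
    (hL : Submodule.span ℝ (L : Set V) = ⊤) : ∃ x ∈ L, x ≠ 0 := by
  by_contra! h
  exact bot_ne_top ((Submodule.span_eq_bot.2 h).symm.trans hL)

/-- Translating by a multiple of `v` brings the component along `v` down to at most half of `v`,
and keeps the component orthogonal to `v`. -/
theorem exists_int_norm_sub_sq_le (v x : V) : ∃ m : ℤ,
    ‖x - m • v‖ ^ 2 ≤ ‖(ℝ ∙ v)ᗮ.orthogonalProjectionOnto x‖ ^ 2 + ‖v‖ ^ 2 / 4 := by
  have hmem : x - (ℝ ∙ v)ᗮ.orthogonalProjectionOnto x ∈ (ℝ ∙ v) := by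
    simp
  obtain ⟨s, hs⟩ := Submodule.mem_span_singleton.1 hmem
  refine ⟨round s, ?_⟩
  set p := (ℝ ∙ v)ᗮ.orthogonalProjectionOnto x
  have hx : x - round s • v = (p : V) + (s - round s) • v := by
    rw [sub_smul, hs, Int.cast_smul_eq_zsmul]; abel
  have hp : inner ℝ (p : V) ((s - round s) • v) = 0 := by
    rw [inner_smul_right, Submodule.mem_orthogonal_singleton_iff_inner_left.1 p.2, mul_zero]
  have h1 := abs_sub_round s
  have h2 : (s - round s) ^ 2 ≤ 1 / 4 := by
    nlinarith [sq_abs (s - round s), abs_nonneg (s - round s)]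
  rw [hx, norm_add_sq_real, hp, norm_smul, mul_pow, Real.norm_eq_abs, sq_abs]
  rw [Submodule.coe_norm]
  linarith [mul_le_mul_of_nonneg_right h2 (sq_nonneg ‖v‖)]

/-- A lattice of rank `m + 1` has a nonzero dual vector whose length, multiplied with the covering
radius of the lattice, is at most `2 ^ m`. -/
theorem exists_dual_vector_covering (m : ℕ) : ∀ (V : Type*) [NormedAddCommGroup V]
    [InnerProductSpace ℝ V] [FiniteDimensional ℝ V] (_ : Module.finrank ℝ V = m + 1)
    (L : AddSubgroup V) (_ : Submodule.span ℝ (L : Set V) = ⊤)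
    (_ : ∃ ε : ℝ, 0 < ε ∧ ∀ x ∈ L, x ≠ 0 → ε ≤ ‖x‖),
    ∃ w : V, w ≠ 0 ∧ (∀ x ∈ L, ∃ k : ℤ, inner ℝ w x = k) ∧
      (∀ r : ℝ, (∀ x ∈ L, x ≠ 0 → r ≤ ‖x‖) → r * ‖w‖ ≤ 2 ^ m) ∧
      ∀ y : V, ∃ x ∈ L, ‖y - x‖ * ‖w‖ ≤ 2 ^ m := by
  induction m with
  | zero =>
    intro V _ _ _ hV L hL ⟨ε, hε, hd⟩
    have : Nontrivial V := Module.nontrivial_of_finrank_eq_succ hV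
    obtain ⟨v, hv, hv0, hvs⟩ :=
      exists_near_shortest L (exists_mem_ne_zero_of_span_eq_top L hL) hε hd
    have hv' : 0 < ‖v‖ := norm_pos_iff.2 hv0
    have hproj : ∀ x : V, (ℝ ∙ v)ᗮ.orthogonalProjectionOnto x = 0 := by
      have : Fact (Module.finrank ℝ V = 0 + 1) := ⟨hV⟩
      have := Submodule.finrank_orthogonal_span_singleton (𝕜 := ℝ) (n := 0) hv0
      have := Module.finrank_zero_iff.1 this
      intro x
      exact Subsingleton.elim _ _
    have hred : ∀ x : V, ∃ k : ℤ, ‖x - k • v‖ ^ 2 ≤ ‖v‖ ^ 2 / 4 := by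
      intro x
      obtain ⟨k, hk⟩ := exists_int_norm_sub_sq_le v x
      refine ⟨k, ?_⟩
      simpa [hproj x] using hk
    have hw : ‖(‖v‖ ^ 2)⁻¹ • v‖ = ‖v‖⁻¹ := by
      rw [norm_smul, norm_inv, norm_pow, norm_norm]; field_simp
    refine ⟨(‖v‖ ^ 2)⁻¹ • v, smul_ne_zero (by positivity) hv0, ?_, ?_, ?_⟩
    · intro x hx
      obtain ⟨k, hk⟩ := hred x
      -- In rank one `L` is `ℤ v`: a nonzero remainder would have squared norm at least `‖v‖ ^ 2 /
      -- 2`, not at most `‖v‖ ^ 2 / 4`.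
      have hx0 : x - k • v = 0 := by
        by_contra h0
        have := hvs _ (L.sub_mem hx (L.zsmul_mem hv k)) h0
        nlinarith
      refine ⟨k, ?_⟩
      rw [sub_eq_zero.1 hx0, ← Int.cast_smul_eq_zsmul ℝ, inner_smul_left, inner_smul_right,
        real_inner_self_eq_norm_sq]
      simp only [map_inv₀, map_pow, conj_trivial]
      field_simp
    · intro r hr
      rw [hw, pow_zero, ← div_eq_mul_inv, div_le_one hv']
      exact hr v hv hv0
    · intro y
      obtain ⟨k, hk⟩ := hred y
      refine ⟨k • v, L.zsmul_mem hv k, ?_⟩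
      rw [hw, pow_zero, ← div_eq_mul_inv, div_le_one hv']
      refine le_of_sq_le_sq (by nlinarith) hv'.le
  | succ m ih =>
    intro V _ _ _ hV L hL ⟨ε, hε, hd⟩
    have : Nontrivial V := Module.nontrivial_of_finrank_eq_succ hV
    obtain ⟨v, hv, hv0, hvs⟩ :=
      exists_near_shortest L (exists_mem_ne_zero_of_span_eq_top L hL) hε hd
    have hv' : 0 < ‖v‖ := norm_pos_iff.2 hv0
    set P := (ℝ ∙ v)ᗮ.orthogonalProjectionOnto with hP
    -- Projecting along `v` keeps a gap: `‖v‖ ^ 2 / 2 - ‖v‖ ^ 2 / 4 = (‖v‖ / 2) ^ 2`.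
    have hlift : ∀ x' ∈ L.map (P : V →+ (ℝ ∙ v)ᗮ), x' ≠ 0 → ‖v‖ / 2 ≤ ‖x'‖ := by
      rintro _ ⟨x, hx, rfl⟩ hx0
      obtain ⟨k, hk⟩ := exists_int_norm_sub_sq_le v x
      have hPv : P v = 0 := by
        rw [hP, Submodule.orthogonalProjectionOnto_orthogonal_apply_eq_zero]
        exact Submodule.mem_span_singleton_self v
      have h0 : x - k • v ≠ 0 := by
        intro h0
        apply hx0
        have : P x = 0 := by rw [sub_eq_zero.1 h0, map_zsmul, hPv, smul_zero]
        simpa using this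
      have := hvs _ (L.sub_mem hx (L.zsmul_mem hv k)) h0
      have hk' : ‖x - k • v‖ ^ 2 ≤ ‖P x‖ ^ 2 + ‖v‖ ^ 2 / 4 := hk
      refine le_of_sq_le_sq (?_ : _ ≤ ‖P x‖ ^ 2) (norm_nonneg (P x))
      linarith
    have hspan : Submodule.span ℝ ((L.map (P : V →+ (ℝ ∙ v)ᗮ) : AddSubgroup _) : Set (ℝ ∙ v)ᗮ)
        = ⊤ := by
      have h1 : ((L.map (P : V →+ (ℝ ∙ v)ᗮ) : AddSubgroup _) : Set (ℝ ∙ v)ᗮ)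
        = (P : V →ₗ[ℝ] (ℝ ∙ v)ᗮ) '' (L : Set V) := rfl
      rw [h1, Submodule.span_image, hL, Submodule.map_top, LinearMap.range_eq_top]
      intro y
      exact ⟨y, by simp [hP]⟩
    have hrank : Module.finrank ℝ (ℝ ∙ v)ᗮ = m + 1 := by
      have : Fact (Module.finrank ℝ V = (m + 1) + 1) := ⟨hV⟩
      exact Submodule.finrank_orthogonal_span_singleton hv0
    obtain ⟨w, hw0, hwd, hwr, hwc⟩ := ih _ hrank _ hspan ⟨‖v‖ / 2, by positivity, hlift⟩
    -- The clause on `r` is carried through the induction for this bound: it controls the part of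
    -- the covering error along `v`.
    have hvw := hwr _ hlift
    have hww : ‖(w : V)‖ = ‖w‖ := rfl
    refine ⟨w, by simpa using hw0, ?_, ?_, ?_⟩
    · intro x hx
      obtain ⟨k, hk⟩ := hwd (P x) ⟨x, hx, rfl⟩
      refine ⟨k, ?_⟩
      rw [← hk, hP, Submodule.inner_orthogonalProjectionOnto_eq_of_mem_left]
    · intro r hr
      have := mul_le_mul_of_nonneg_right (hr v hv hv0) (norm_nonneg w)
      rw [hww, pow_succ]
      linarith
    · intro y
      obtain ⟨_, ⟨x, hx, rfl⟩, hxc⟩ := hwc (P y)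
      obtain ⟨k, hk⟩ := exists_int_norm_sub_sq_le v (y - x)
      refine ⟨x + k • v, L.add_mem hx (L.zsmul_mem hv k), ?_⟩
      have hk' : ‖y - (x + k • v)‖ ^ 2 ≤ ‖P y - P x‖ ^ 2 + ‖v‖ ^ 2 / 4 := by
        rw [← map_sub, ← sub_sub]; exact hk
      have hxc' : ‖P y - P x‖ * ‖w‖ ≤ 2 ^ m := hxc
      -- By Pythagoras the two errors add in squares: `4 ^ m + 4 ^ m ≤ 4 ^ (m + 1)`.
      refine le_of_sq_le_sq ?_ (by positivity)
      have e1 : (‖P y - P x‖ * ‖w‖) ^ 2 ≤ (2 ^ m) ^ 2 := pow_le_pow_left₀ (by positivity) hxc' 2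
      have e2 : (‖v‖ / 2 * ‖w‖) ^ 2 ≤ (2 ^ m) ^ 2 := pow_le_pow_left₀ (by positivity) hvw 2
      have e3 := mul_le_mul_of_nonneg_right hk' (sq_nonneg ‖w‖)
      calc (‖y - (x + k • v)‖ * ‖(w : V)‖) ^ 2
          ≤ (‖P y - P x‖ * ‖w‖) ^ 2 + (‖v‖ / 2 * ‖w‖) ^ 2 := by rw [hww]; linarith
        _ ≤ (2 ^ (m + 1)) ^ 2 := by rw [pow_succ 2 m]; linarith [sq_nonneg ((2 : ℝ) ^ m)]

/-! ### Scaling along an axis -/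

/-- For a unit vector `α`, the linear map which multiplies the component orthogonal to `α` by `s`
and the component along `α` by `t`. -/
noncomputable def axialScaling (α : V) (s t : ℝ) : V →ₗ[ℝ] V :=
  s • LinearMap.id + (t - s) • (innerₛₗ ℝ α).smulRight α

theorem axialScaling_apply (α : V) (s t : ℝ) (y : V) :
    axialScaling α s t y = s • y + ((t - s) * inner ℝ α y) • α := by
  simp [axialScaling, smul_smul]

theorem inner_axialScaling {α : V} (hα : ‖α‖ = 1) (s t : ℝ) (y : V) :
    inner ℝ α (axialScaling α s t y) = t * inner ℝ α y := by
  rw [axialScaling_apply, inner_add_right, inner_smul_right, inner_smul_right,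
    real_inner_self_eq_norm_sq, hα]
  ring

theorem axialScaling_sub_inner_smul {α : V} (hα : ‖α‖ = 1) (s t : ℝ) (y : V) :
    axialScaling α s t y - (inner ℝ α (axialScaling α s t y) : ℝ) • α =
      s • (y - (inner ℝ α y : ℝ) • α) := by
  rw [inner_axialScaling hα, axialScaling_apply]
  module

theorem axialScaling_inv_apply {α : V} (hα : ‖α‖ = 1) {s t : ℝ} (hs : s ≠ 0) (ht : t ≠ 0) (y : V) :
    axialScaling α s t (axialScaling α s⁻¹ t⁻¹ y) = y := by
  rw [axialScaling_apply, inner_axialScaling hα, axialScaling_apply]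
  match_scalars <;> (field_simp; try ring)

theorem inner_axialScaling_left (α : V) (s t : ℝ) (x y : V) :
    inner ℝ (axialScaling α s t x) y = inner ℝ x (axialScaling α s t y) := by
  simp only [axialScaling_apply, inner_add_left, inner_add_right, inner_smul_left,
    inner_smul_right, conj_trivial, real_inner_comm α x]
  ring

theorem abs_inner_le_norm_of_unit {α : V} (hα : ‖α‖ = 1) (x : V) : |inner ℝ α x| ≤ ‖x‖ := by
  simpa [hα] using abs_real_inner_le_norm α x

theorem norm_sub_inner_smul_le {α : V} (hα : ‖α‖ = 1) (x : V) : ‖x - (inner ℝ α x : ℝ) • α‖ ≤ ‖x‖ := by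
  refine le_of_sq_le_sq ?_ (norm_nonneg x)
  rw [norm_sub_sq_real, inner_smul_right, norm_smul, hα, Real.norm_eq_abs, real_inner_comm x α,
    mul_one, sq_abs]
  linarith [sq_nonneg (inner ℝ x α : ℝ)]

end Reduction

/-! ### The integer lattice -/

theorem intVec_apply {n : ℕ} (k : Fin n → ℤ) (i : Fin n) : intVec n k i = k i := rfl

theorem one_le_norm_intVec {n : ℕ} {k : Fin n → ℤ} (hk : k ≠ 0) : 1 ≤ ‖intVec n k‖ := by
  obtain ⟨i, hi⟩ := Function.ne_iff.1 hk
  have h1 : ‖intVec n k i‖ ≤ ‖intVec n k‖ := PiLp.norm_apply_le _ i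
  have h2 : (1 : ℝ) ≤ |(k i : ℝ)| := by exact_mod_cast Int.one_le_abs hi
  rw [intVec_apply, Real.norm_eq_abs] at h1
  exact h2.trans h1

theorem intVec_single {n : ℕ} (i : Fin n) :
    intVec n (Pi.single i 1) = EuclideanSpace.single i (1 : ℝ) := by
  ext j
  rw [intVec_apply, PiLp.single_apply, Pi.single_apply]
  split_ifs <;> simp

theorem span_integerLattice (n : ℕ) :
    Submodule.span ℝ (integerLattice n : Set (EuclideanSpace ℝ (Fin n))) = ⊤ := by
  rw [eq_top_iff, ← (EuclideanSpace.basisFun (Fin n) ℝ).toBasis.span_eq]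
  refine Submodule.span_mono ?_
  rintro _ ⟨i, rfl⟩
  exact ⟨Pi.single i 1, by simp [intVec_single]⟩

/-- `ℤⁿ` is its own dual lattice: pairing with the standard basis reads off the coordinates. -/
theorem exists_intVec_eq {n : ℕ} (v : EuclideanSpace ℝ (Fin n))
    (hv : ∀ x ∈ integerLattice n, ∃ k : ℤ, inner ℝ v x = k) : ∃ k, intVec n k = v := by
  have h : ∀ i, ∃ k : ℤ, v i = k := fun i => by
    obtain ⟨k, hk⟩ := hv _ ⟨Pi.single i 1, rfl⟩
    refine ⟨k, ?_⟩
    rw [← hk, intVec_single, EuclideanSpace.inner_single_right]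
    simp
  choose k hk using h
  exact ⟨k, by ext i; rw [intVec_apply, hk]⟩

/-- Either some nonzero integer vector is thin along the convex body of the vectors with component
at most `a` along `α` and at most `b` orthogonal to `α`, or the integer translates of this body
cover the space. -/
theorem exists_short_intVec_or_covering {n : ℕ} (hn : n ≠ 0) {α : EuclideanSpace ℝ (Fin n)}
    (hα : ‖α‖ = 1) {a b c : ℝ} (ha : 0 < a) (hb : 0 < b) (hc : 2 ^ (n - 1) ≤ c) :
    (∃ k : Fin n → ℤ, k ≠ 0 ∧ a * |inner ℝ α (intVec n k)| < c ∧
      b * ‖intVec n k - (inner ℝ α (intVec n k) : ℝ) • α‖ < c) ∨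
    ∀ y : EuclideanSpace ℝ (Fin n), ∃ k : Fin n → ℤ, |inner ℝ α (y - intVec n k)| ≤ a ∧
      ‖(y - intVec n k) - (inner ℝ α (y - intVec n k) : ℝ) • α‖ ≤ b := by
  obtain ⟨m, rfl⟩ := Nat.exists_eq_succ_of_ne_zero hn
  set A := axialScaling α b⁻¹ a⁻¹ with hA
  set B := axialScaling α b a with hB
  have hAB : ∀ y, A (B y) = y := fun y => by
    have := axialScaling_inv_apply hα (inv_ne_zero hb.ne') (inv_ne_zero ha.ne') y
    rwa [inv_inv, inv_inv] at this
  have hBA : ∀ y, B (A y) = y := axialScaling_inv_apply hα hb.ne' ha.ne'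
  have hin : ∀ y, |inner ℝ α (B y)| = a * |inner ℝ α y| := fun y => by
    rw [hB, inner_axialScaling hα, abs_mul, abs_of_pos ha]
  have hperp : ∀ y, ‖B y - (inner ℝ α (B y) : ℝ) • α‖ = b * ‖y - (inner ℝ α y : ℝ) • α‖ :=
    fun y => by rw [hB, axialScaling_sub_inner_smul hα, norm_smul, Real.norm_of_nonneg hb.le]
  have hnorm : ∀ y, ‖B y‖ ≤ (a + b) * ‖y‖ := fun y => by
    calc ‖B y‖ = ‖(B y - (inner ℝ α (B y) : ℝ) • α) + (inner ℝ α (B y) : ℝ) • α‖ := by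
          rw [sub_add_cancel]
      _ ≤ b * ‖y - (inner ℝ α y : ℝ) • α‖ + a * |inner ℝ α y| := by
          refine (norm_add_le _ _).trans_eq ?_
          rw [hperp, norm_smul, hα, mul_one, Real.norm_eq_abs, hin]
      _ ≤ b * ‖y‖ + a * ‖y‖ := by
          gcongr
          · exact norm_sub_inner_smul_le hα y
          · exact abs_inner_le_norm_of_unit hα y
      _ = (a + b) * ‖y‖ := by ring
  obtain ⟨w, hw0, hwd, -, hwc⟩ := exists_dual_vector_covering m (EuclideanSpace ℝ (Fin (m + 1)))
    (by simp) ((integerLattice (m + 1)).map (A : _ →+ EuclideanSpace ℝ (Fin (m + 1)))) (by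
      have : (((integerLattice (m + 1)).map (A : _ →+ EuclideanSpace ℝ (Fin (m + 1))) :
        AddSubgroup _) : Set (EuclideanSpace ℝ (Fin (m + 1)))) = A '' integerLattice (m + 1) := rfl
      rw [this, Submodule.span_image, span_integerLattice, Submodule.map_top,
        LinearMap.range_eq_top]
      exact fun y => ⟨B y, hAB y⟩) ⟨(a + b)⁻¹, by positivity, by
      rintro _ ⟨_, ⟨k, rfl⟩, rfl⟩ h0
      have hk : k ≠ 0 := by
        rintro rfl
        simp at h0
      have := hnorm (A (intVec (m + 1) k))
      rw [hBA] at this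
      rw [inv_le_iff_one_le_mul₀' (by positivity)]
      exact (one_le_norm_intVec hk).trans this⟩
  -- `A` is self-adjoint, so it carries the dual of `A ℤⁿ` into the dual of `ℤⁿ`.
  obtain ⟨k, hk⟩ := exists_intVec_eq (A w) fun x hx => by
    obtain ⟨k, hk⟩ := hwd (A x) ⟨x, hx, rfl⟩
    exact ⟨k, by rw [← hk, hA, inner_axialScaling_left]⟩
  have hkw : B (intVec (m + 1) k) = w := by
    have := axialScaling_inv_apply hα hb.ne' ha.ne' w
    rw [hk, hBA]
  rcases lt_or_ge ‖w‖ c with hlt | hge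
  · left
    refine ⟨k, ?_, ?_, ?_⟩
    · rintro rfl
      rw [map_zero, map_zero] at hkw
      exact hw0 hkw.symm
    · rw [← hin, hkw]
      exact (abs_inner_le_norm_of_unit hα w).trans_lt hlt
    · rw [← hperp, hkw]
      exact (norm_sub_inner_smul_le hα w).trans_lt hlt
  · right
    intro y
    obtain ⟨_, ⟨_, ⟨l, rfl⟩, rfl⟩, hl⟩ := hwc (A y)
    have hl' : ‖A (y - intVec (m + 1) l)‖ * ‖w‖ ≤ 1 * ‖w‖ := by
      rw [map_sub, one_mul]
      exact hl.trans (hc.trans hge)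
    have hle : ‖A (y - intVec (m + 1) l)‖ ≤ 1 := le_of_mul_le_mul_right hl' (norm_pos_iff.2 hw0)
    refine ⟨l, ?_, ?_⟩
    · rw [← hBA (y - intVec (m + 1) l), hin]
      exact mul_le_of_le_one_right ha.le ((abs_inner_le_norm_of_unit hα _).trans hle)
    · rw [← hBA (y - intVec (m + 1) l), hperp]
      exact mul_le_of_le_one_right hb.le ((norm_sub_inner_smul_le hα _).trans hle)

/-! ### The linear flow -/

theorem fillsWithin_of_covering {n : ℕ} {α : EuclideanSpace ℝ (Fin n)} {a δ : ℝ}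
    (h : ∀ y : EuclideanSpace ℝ (Fin n), ∃ k : Fin n → ℤ, |inner ℝ α (y - intVec n k)| ≤ a ∧
      ‖(y - intVec n k) - (inner ℝ α (y - intVec n k) : ℝ) • α‖ ≤ δ) :
    FillsWithin α δ (2 * a) := by
  intro θ p
  obtain ⟨x, rfl⟩ := QuotientAddGroup.mk_surjective θ
  obtain ⟨z, rfl⟩ := QuotientAddGroup.mk_surjective p
  -- The shift by `a • α` moves the time window from `[-a, a]` to `[0, 2 * a]`.
  obtain ⟨k, hk1, hk2⟩ := h (z - x - a • α)
  set s : ℝ := inner ℝ α (z - x - a • α - intVec n k)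
  obtain ⟨hs1, hs2⟩ := abs_le.1 hk1
  refine ⟨_, ?_, ⟨a + s, ⟨by linarith, by linarith⟩, rfl⟩⟩
  have hmk : linearFlow α (a + s) (QuotientAddGroup.mk x : FlatTorus n) =
      QuotientAddGroup.mk (x + (a + s) • α + intVec n k) := by
    rw [linearFlow, ← QuotientAddGroup.mk_add]
    refine QuotientAddGroup.eq.2 ⟨k, ?_⟩
    abel
  rw [Metric.mem_closedBall]
  beta_reduce
  rw [hmk, dist_comm, dist_eq_norm, ← QuotientAddGroup.mk_sub]
  refine (QuotientAddGroup.norm_mk_le_norm).trans (le_of_eq_of_le ?_ hk2)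
  congr 1
  module

theorem two_pow_le_sq_mul_factorial {n : ℕ} (hn : 2 ≤ n) : 2 ^ n ≤ n ^ 2 * n ! := by
  induction n, hn using Nat.le_induction with
  | base => decide
  | succ n hn ih =>
    rw [pow_succ, Nat.factorial_succ]
    calc 2 ^ n * 2 ≤ n ^ 2 * n ! * (n + 1) := Nat.mul_le_mul ih (by omega)
      _ ≤ (n + 1) ^ 2 * n ! * (n + 1) := by gcongr; omega
      _ = (n + 1) ^ 2 * ((n + 1) * n !) := by ring

theorem theorem1 (n : ℕ) (hn : 2 ≤ n) (τ γ : ℝ) (hτ : (n : ℝ) - 1 < τ)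
    (hγ : γ ∈ Set.Ioo (0 : ℝ) 1) (hne : (diophantineUnit n τ γ).Nonempty)
    (δ : ℝ) (hδ : δ ∈ Set.Ioo (0 : ℝ) (1 / 2))
    (α : EuclideanSpace ℝ (Fin n))
    (hα : α ∈ truncDiophantineUnit n τ γ (criticalOrder n δ)) :
    ∃ T : ℝ, 0 ≤ T ∧ T < (1 + (n : ℝ) ^ 2 * (n ! : ℝ)) ^ (τ + 1) / (γ * δ ^ τ) ∧
      FillsWithin α δ T := by
  obtain ⟨hγ0, hγ1⟩ := hγ
  obtain ⟨hδ0, hδ1⟩ := hδ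
  obtain ⟨hα1, hαd⟩ := hα
  rw [mem_sphere_zero_iff_norm] at hα1
  have hn' : (2 : ℝ) ≤ n := by exact_mod_cast hn
  have hτ0 : 0 < τ := by linarith
  set D : ℝ := (n : ℝ) ^ 2 * (n ! : ℝ) with hD
  have hD2 : (2 : ℝ) ^ n ≤ D := by rw [hD]; exact_mod_cast two_pow_le_sq_mul_factorial hn
  have hD0 : 0 < D := lt_of_lt_of_le (by positivity) hD2
  have hN : criticalOrder n δ = (1 + D) / δ := rfl
  have hN1 : 1 ≤ (1 + D) / δ := by rw [le_div_iff₀ hδ0]; linarith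
  rw [hN] at hαd
  set N : ℝ := (1 + D) / δ
  have hN0 : 0 < N := by linarith
  have hNτ : 0 < N ^ τ := Real.rpow_pos_of_pos hN0 τ
  have hc : (2 : ℝ) ^ (n - 1) ≤ D / 2 := by
    obtain ⟨m, rfl⟩ : ∃ m, n = m + 1 := ⟨n - 1, by omega⟩
    rw [pow_succ] at hD2
    rw [Nat.add_sub_cancel]
    linarith
  -- Chosen so that `a * |k · α| < D / 2` reads `|k · α| < γ * N ^ (-τ)`; then `2 * a = D * N ^ τ /
  -- γ`.
  set a : ℝ := D / 2 * N ^ τ / γ with ha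
  have ha0 : 0 < a := by positivity
  refine ⟨2 * a, by positivity, ?_, fillsWithin_of_covering ?_⟩
  · have h1 : (1 + D) ^ (τ + 1) / (γ * δ ^ τ) = (1 + D) * N ^ τ / γ := by
      rw [Real.div_rpow (by positivity) hδ0.le, Real.rpow_add_one (by positivity)]
      have : 0 < δ ^ τ := Real.rpow_pos_of_pos hδ0 τ
      field_simp
    rw [h1, show 2 * a = D * N ^ τ / γ by rw [ha]; ring]
    gcongr
    linarith
  · refine (exists_short_intVec_or_covering (by omega) hα1 ha0 hδ0 hc).resolve_left ?_
    rintro ⟨k, hk0, hk1, hk2⟩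
    have hin : |inner ℝ α (intVec n k)| < γ * N ^ (-τ) := by
      rw [Real.rpow_neg hN0.le, ← div_eq_mul_inv, lt_div_iff₀ hNτ]
      rw [ha, div_mul_eq_mul_div, div_lt_iff₀ hγ0, mul_assoc] at hk1
      have := lt_of_mul_lt_mul_left hk1 (by positivity)
      linarith
    have hpos : 0 < ‖intVec n k‖ := lt_of_lt_of_le one_pos (one_le_norm_intVec hk0)
    -- The component of `k` along `α` is at most 1 and the orthogonal one is below `D / (2 * δ)`; as
    -- `δ < 1 / 2`, their sum stays below `(1 + D) / δ`.
    have hle : ‖intVec n k‖ ≤ N := by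
      have h1 : N ^ (-τ) ≤ 1 := Real.rpow_le_one_of_one_le_of_nonpos hN1 (by linarith)
      have h2 : |inner ℝ α (intVec n k)| ≤ 1 := hin.le.trans (mul_le_one₀ hγ1.le (by positivity) h1)
      have h3 := norm_add_le (intVec n k - (inner ℝ α (intVec n k) : ℝ) • α)
        ((inner ℝ α (intVec n k) : ℝ) • α)
      rw [sub_add_cancel, norm_smul _ α, hα1, mul_one, Real.norm_eq_abs] at h3
      rw [le_div_iff₀ hδ0]
      nlinarith
    have h4 := hαd k hpos hle
    rw [real_inner_comm] at h4
    have h5 : N ^ (-τ) ≤ ‖intVec n k‖ ^ (-τ) :=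
      Real.rpow_le_rpow_of_nonpos hpos hle (by linarith)
    linarith [mul_le_mul_of_nonneg_left h5 hγ0.le]
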